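/- Let $(Y_t)_{t\in\mathbb Z}$ be a real time series, let $\Omega_t$ denote the history $(Y_{t-1},Y_{t-2},\dots)$, and let $F_t(\cdot\mid\Omega_t,\theta)$, $\theta\in\Theta\subseteq\mathbb R^L$, be a parametric family of conditional distribution functions, continuous and strictly increasing in $y$ for every $\theta$ and every history. For $\theta\in\Theta$ put $U_t(\theta)=F_t(Y_t\mid\Omega_t,\theta)$ and, for $u,v\in\Theta$, $\eta_t(r,u,v)=F_t\big(F_t^{-1}(r\mid\Omega_t,u)\mid\Omega_t,v\big)$. For estimators $\hat\theta=\hat\theta_n$ with values in $\Theta$ let $\hat U_t=U_t(\hat\theta_n)$ and $$\hat V_{2n}(r)=\frac1{\sqrt{n-1}}\sum_{t=2}^n\big[I(\hat U_t\le r_1)I(\hat U_{t-1}\le r_2)-r_1r_2\big],\qquad r=(r_1,r_2)\in[0,1]^2 .$$ Assume: 1. For all $\theta_0\in\Theta$ and $r\in[0,1]^2$ the (nonrandom) limit in probability $P_2(r)=P_2(r;\theta_0)=\operatorname{plim}_{n\to\infty} n^{-1}\sum_{t=1}^n I(U_t(\theta_0)\le r_1)I(U_{t-1}(\theta_0)\le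 r_2)$ exists. 2. (Fixed alternative $H_1$) For every $\theta_0\in\Theta$ there is $r\in[0,1]^2$ with $\bar P_2(r)=P_2(r;\theta_0)-r_1r_2\neq0$. 3. (Pseudo-true limit) $\hat\theta_n\to\theta_1$ in probability for some $\theta_1\in\Theta$; let $a_n>0$, $a_n\to0$, be a rate for this convergence, $\hat\theta_n-\theta_1=O_p(a_n)$ (for instance $a_n=n^{-1/2}$). 4. (Smoothness) For every $M>0$, $$E\sup_{1\le t\le n}\ \sup_{u\in\Theta,\,\|u-\theta_1\|\le Ma_n}\ \sup_{r\in[0,1]}|\eta_t(r,u,\theta_1)-r|=O(a_n).$$ Then for every sequence of random variables $c_n=O_p(1)$, $$\lim_{n\to\infty}P\big(\Gamma(\hat V_{2n})>c_n\big)=1$$ for the Kolmogorov–Smirnov functional $\Gamma(v)=\sup_{[0,1]^2}|v|$, for the Cramér–von Mises functional $\Gamma(v)=\int_{[0,1]^2}v(r)^2\,dr$, and, more generally, for every real functional $\Gamma$ of functions on $[0,1]^2$ for which the $\Gamma(\hat V_{2n})$ are random variables and such that $\Gamma(v_n)\to\infty$ whenever $v_n$ are bounded measurable functions on $[0,1]^2$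 with $|v_n|\to\infty$ uniformly on some nonempty open subset of $[0,1]^2$. That is, the tests rejecting when $\Gamma(\hat V_{2n})>c_n$ are consistent against $H_1$. -/

import Mathlib

open MeasureTheory Filter Topology
open scoped ENNReal unitInterval

noncomputable section

/-- A parametric family of conditional distribution functions `F_t(y | Ω_t, θ)`, `θ ∈ Θ ⊆ ℝ^L`.
The conditioning information is the history `x = (Y_{t-1}, Y_{t-2}, …)`, so `F t θ x y` stands for
`F_t(y | x, θ)`.  Each `F t θ x` is a distribution function on `ℝ`. -/
structure CondCdfFamily {L : ℕ} (Θ : Set (EuclideanSpace ℝ (Fin L))) where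
  F : ℤ → Θ → (ℕ → ℝ) → ℝ → ℝ
  measurable_F : ∀ t, Measurable fun p : Θ × (ℕ → ℝ) × ℝ => F t p.1 p.2.1 p.2.2
  monotone_F : ∀ t θ x, Monotone (F t θ x)
  rightContinuous_F : ∀ t θ x y, ContinuousWithinAt (F t θ x) (Set.Ici y) y
  tendsto_atBot_F : ∀ t θ x, Tendsto (F t θ x) atBot (𝓝 0)
  tendsto_atTop_F : ∀ t θ x, Tendsto (F t θ x) atTop (𝓝 1)

/-- The history `(Y_{t-1}, Y_{t-2}, …)` before time `t`. -/
def history {S : Type*} (Y : ℤ → S → ℝ) (t : ℤ) (ω : S) : ℕ → ℝ :=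
  fun k => Y (t - 1 - k) ω

/-- The generalized quantile `inf {y | p ≤ G y}`; the inverse of `G` on `(0,1)` when `G` is a
continuous strictly increasing distribution function. -/
def quantile (G : ℝ → ℝ) (p : ℝ) : ℝ := sInf {y | p ≤ G y}

/-- The indicator `I(x ≤ y)`. -/
def indLe (x y : ℝ) : ℝ := if x ≤ y then 1 else 0

namespace CondCdfFamily

variable {L : ℕ} {Θ : Set (EuclideanSpace ℝ (Fin L))} (m : CondCdfFamily Θ)

/-- All the `F_t(· | Ω_t, θ)` are continuous and strictly increasing. -/
def ContinuousStrictlyIncreasing : Prop :=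
  ∀ t θ x, Continuous (m.F t θ x) ∧ StrictMono (m.F t θ x)

/-- `η_t(r, u, v) = F_t(F_t⁻¹(r | u) | v)` given the history `x`, with `F_t⁻¹(0 | u) = -∞` and
`F_t⁻¹(1 | u) = +∞`. -/
def eta (t : ℤ) (r : ℝ) (u v : Θ) (x : ℕ → ℝ) : ℝ :=
  if r = 0 then 0 else if r = 1 then 1 else m.F t v x (quantile (m.F t u x) r)

/-- The generalized residual `U_t = F_t(Y_t | Ω_t, θ)`. -/
def residual {S : Type*} (Y : ℤ → S → ℝ) (θ : Θ) (t : ℤ) (ω : S) : ℝ :=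
  m.F t θ (history Y t ω) (Y t ω)

/-- `n⁻¹ ∑_{t=1}^n I(U_t ≤ r₁) I(U_{t-1} ≤ r₂)`, with `U_t` computed at the fixed parameter `θ`. -/
def empiricalJointCdf {S : Type*} (Y : ℤ → S → ℝ) (θ : Θ) (r : I × I) (n : ℕ) (ω : S) : ℝ :=
  (1 / (n : ℝ)) * ∑ t ∈ Finset.Icc 1 n,
    indLe (m.residual Y θ (t : ℤ) ω) r.1 * indLe (m.residual Y θ ((t : ℤ) - 1) ω) r.2

/-- The process `V̂_{2n}` on `[0,1]²`, with `Û_t = F_t(Y_t | Ω_t, θ̂_n)`. -/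
def Vhat {S : Type*} (Y : ℤ → S → ℝ) (θhat : ℕ → S → Θ) (n : ℕ) (ω : S) (r : I × I) : ℝ :=
  (1 / √((n : ℝ) - 1)) * ∑ t ∈ Finset.Icc 2 n,
    (indLe (m.residual Y (θhat n ω) (t : ℤ) ω) r.1 *
      indLe (m.residual Y (θhat n ω) ((t : ℤ) - 1) ω) r.2 - (r.1 : ℝ) * (r.2 : ℝ))

end CondCdfFamily

/-- The (outer) expectation of a nonnegative function; it is the ordinary expectation when the
function is measurable. -/
def outerExpectation {S : Type*} [MeasurableSpace S] (μ : Measure S) (f : S → ℝ≥0∞) : ℝ≥0∞ :=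
  ⨅ (g : S → ℝ≥0∞) (_ : Measurable g) (_ : ∀ ω, f ω ≤ g ω), ∫⁻ ω, g ω ∂μ

/-- Smoothness of the family at `θ₀` on balls of radius of order `a n`: for every `M > 0`,
`E sup_{1≤t≤n} sup_{u ∈ Θ, ‖u-θ₀‖ ≤ M a_n} sup_{r∈[0,1]} |η_t(r,u,θ₀) - r| = O(a_n)`. -/
def CondCdfFamily.SmoothAt {L : ℕ} {Θ : Set (EuclideanSpace ℝ (Fin L))} (m : CondCdfFamily Θ)
    {S : Type*} [MeasurableSpace S] (μ : Measure S) (Y : ℤ → S → ℝ) (a : ℕ → ℝ) (θ₀ : Θ) : Prop :=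
  ∀ M : ℝ, 0 < M → ∃ C : ℝ, ∀ᶠ n : ℕ in atTop,
    outerExpectation μ (fun ω =>
      ⨆ t ∈ Finset.Icc 1 n, ⨆ u : Θ, ⨆ _ : ‖(u : EuclideanSpace ℝ (Fin L)) - θ₀‖ ≤ M * a n,
        ⨆ r : I, ENNReal.ofReal |m.eta (t : ℤ) r u θ₀ (history Y t ω) - r|)
      ≤ ENNReal.ofReal (C * a n)

/-- `X_n = O_p(a_n)`. -/
def IsBigOInProb {S E : Type*} [MeasurableSpace S] [Norm E] (μ : Measure S)
    (X : ℕ → S → E) (a : ℕ → ℝ) : Prop :=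
  ∀ ε : ℝ≥0∞, 0 < ε → ∃ M : ℝ, ∀ᶠ n in atTop, μ {ω | M * a n < ‖X n ω‖} ≤ ε

/-- Kolmogorov–Smirnov functional `sup_{[0,1]²} |v|`. -/
def ksFunctional (v : I × I → ℝ) : ℝ := ⨆ r, |v r|

/-- Cramér–von Mises functional `∫_{[0,1]²} v(r)² dr`. -/
def cvmFunctional (v : I × I → ℝ) : ℝ := ∫ r, v r ^ 2

/-- `Γ(v_n) → ∞` along every sequence of bounded measurable functions on `[0,1]²` for which
`|v_n| → ∞` uniformly on some nonempty open set. -/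
def DetectsDivergence (Γ : (I × I → ℝ) → ℝ) : Prop :=
  ∀ R : Set (I × I), IsOpen R → R.Nonempty → ∀ v : ℕ → I × I → ℝ,
    (∀ n, Measurable (v n)) → (∀ n, ∃ C : ℝ, ∀ r, |v n r| ≤ C) →
    (∀ K : ℝ, ∀ᶠ n in atTop, ∀ r ∈ R, K ≤ |v n r|) →
    Tendsto (fun n => Γ (v n)) atTop atTop

end

/-! Since every parameter is ruled out by the alternative, so is the pseudo-true value `θ₁`: the
limit `P` of the empirical joint distributions at `θ₁` differs from `r₁r₂` somewhere, and in fact at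
an interior point `r₀` (`exists_interior_ne`), because values of `P` on the boundary are forced by
those inside.

The estimated residual satisfies `Û_t ≤ r` exactly when `U_t(θ₁) ≤ η_t(r, θ̂, θ₁)`
(`residual_le_iff_eta`), and with probability tending to one every `η_t` is within a fixed `δ` of
`r`. Counts are monotone in `r`. If `P r₀` is too small, estimated counts on a box slightly below
and left of `r₀` are at most the counts at `r₀` under `θ₁`; if it is too large, a box above and
right of `r₀` reverses the comparison. For small `δ` the product `r₁r₂` barely moves on the box, so
`|V̂|` is of order `√n` there (`exists_isOpen_le_abs_Vhat`). Only convergence at the single point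
`r₀` is needed, with neither continuity of `P` nor uniform convergence.

A functional detecting divergence then exceeds any fixed level once `|v|` is large on the box, hence
exceeds `c_n` up to small probability. -/

/-! ### Conditional distribution functions, quantiles and indicators -/

namespace CondCdfFamily

variable {L : ℕ} {Θ : Set (EuclideanSpace ℝ (Fin L))} {m : CondCdfFamily Θ}

lemma ContinuousStrictlyIncreasing.F_pos (hF : m.ContinuousStrictlyIncreasing) (t : ℤ) (θ : Θ)
    (x : ℕ → ℝ) (y : ℝ) : 0 < m.F t θ x y :=
  ((m.monotone_F t θ x).le_of_tendsto (m.tendsto_atBot_F t θ x) (y - 1)).trans_lt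
    ((hF t θ x).2 (by linarith))

lemma ContinuousStrictlyIncreasing.F_lt_one (hF : m.ContinuousStrictlyIncreasing) (t : ℤ) (θ : Θ)
    (x : ℕ → ℝ) (y : ℝ) : m.F t θ x y < 1 :=
  ((hF t θ x).2 (by linarith : y < y + 1)).trans_le
    ((m.monotone_F t θ x).ge_of_tendsto (m.tendsto_atTop_F t θ x) (y + 1))

lemma ContinuousStrictlyIncreasing.exists_F_eq (hF : m.ContinuousStrictlyIncreasing) (t : ℤ)
    (θ : Θ) (x : ℕ → ℝ) {r : ℝ} (h0 : 0 < r) (h1 : r < 1) : ∃ y, m.F t θ x y = r := by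
  obtain ⟨y₀, hy₀⟩ := ((m.tendsto_atBot_F t θ x).eventually_lt_const h0).exists
  obtain ⟨y₁, hy₁⟩ := ((m.tendsto_atTop_F t θ x).eventually_const_lt h1).exists
  exact mem_range_of_exists_le_of_exists_ge (hF t θ x).1 ⟨y₀, hy₀.le⟩ ⟨y₁, hy₁.le⟩

end CondCdfFamily

lemma quantile_apply_of_strictMono {G : ℝ → ℝ} (hG : StrictMono G) (y : ℝ) :
    quantile G (G y) = y := by
  have : {z | G y ≤ G z} = Set.Ici y := by
    ext z
    simp [hG.le_iff_le]
  rw [quantile, this, csInf_Ici]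

lemma indLe_nonneg (x y : ℝ) : 0 ≤ indLe x y := by
  unfold indLe; split_ifs <;> norm_num

lemma indLe_le_one (x y : ℝ) : indLe x y ≤ 1 := by
  unfold indLe; split_ifs <;> norm_num

lemma indLe_le_indLe {x y x' y' : ℝ} (h : x ≤ y → x' ≤ y') : indLe x y ≤ indLe x' y' := by
  unfold indLe
  split_ifs with h₁ h₂
  · exact le_rfl
  · exact absurd (h h₁) h₂
  · norm_num
  · exact le_rfl

lemma indLe_of_le {x y : ℝ} (h : x ≤ y) : indLe x y = 1 := if_pos h

lemma indLe_of_lt {x y : ℝ} (h : y < x) : indLe x y = 0 := if_neg h.not_ge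

lemma measurable_indLe_left (x : ℝ) : Measurable (indLe x) :=
  Measurable.ite measurableSet_Ici measurable_const measurable_const

/-! ### Change of parameter and order properties of the empirical joint distribution -/

namespace CondCdfFamily

variable {L : ℕ} {Θ : Set (EuclideanSpace ℝ (Fin L))} {m : CondCdfFamily Θ} {S : Type*}

/-- For `0 < r < 1` both sides say that `Y_t` is at most the `r`-quantile under `u`. At the
endpoints the conventions for `eta` agree with the residuals lying strictly between 0 and 1. -/
lemma residual_le_iff_eta (hF : m.ContinuousStrictlyIncreasing) (Y : ℤ → S → ℝ) (u v : Θ) (t : ℤ)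
    (ω : S) (r : I) :
    m.residual Y u t ω ≤ r ↔ m.residual Y v t ω ≤ m.eta t r u v (history Y t ω) := by
  unfold residual eta
  split_ifs with h0 h1
  · rw [h0]
    exact iff_of_false (hF.F_pos _ _ _ _).not_ge (hF.F_pos _ _ _ _).not_ge
  · rw [h1]
    exact iff_of_true (hF.F_lt_one _ _ _ _).le (hF.F_lt_one _ _ _ _).le
  · obtain ⟨y, hy⟩ := hF.exists_F_eq t u (history Y t ω)
      (lt_of_le_of_ne r.2.1 (Ne.symm h0)) (lt_of_le_of_ne r.2.2 h1)
    rw [← hy, quantile_apply_of_strictMono (hF _ _ _).2, (hF _ _ _).2.le_iff_le,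
      (hF _ _ _).2.le_iff_le]

lemma empiricalJointCdf_mono (Y : ℤ → S → ℝ) (θ : Θ) {r s : I × I} (h : r ≤ s) (n : ℕ) (ω : S) :
    m.empiricalJointCdf Y θ r n ω ≤ m.empiricalJointCdf Y θ s n ω := by
  unfold empiricalJointCdf
  refine mul_le_mul_of_nonneg_left (Finset.sum_le_sum fun t _ => ?_) (by positivity)
  exact mul_le_mul (indLe_le_indLe fun h' => h'.trans h.1) (indLe_le_indLe fun h' => h'.trans h.2)
    (indLe_nonneg _ _) (indLe_nonneg _ _)

lemma empiricalJointCdf_zero_left (hF : m.ContinuousStrictlyIncreasing) (Y : ℤ → S → ℝ) (θ : Θ)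
    (s : I) (n : ℕ) (ω : S) : m.empiricalJointCdf Y θ (0, s) n ω = 0 := by
  unfold empiricalJointCdf
  rw [Finset.sum_eq_zero, mul_zero]
  intro t _
  rw [indLe_of_lt (by exact hF.F_pos _ _ _ _), zero_mul]

lemma empiricalJointCdf_zero_right (hF : m.ContinuousStrictlyIncreasing) (Y : ℤ → S → ℝ) (θ : Θ)
    (s : I) (n : ℕ) (ω : S) : m.empiricalJointCdf Y θ (s, 0) n ω = 0 := by
  unfold empiricalJointCdf
  rw [Finset.sum_eq_zero, mul_zero]
  intro t _
  rw [indLe_of_lt (x := m.residual Y θ ((t : ℤ) - 1) ω) (by exact hF.F_pos _ _ _ _), mul_zero]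

lemma empiricalJointCdf_one_one (hF : m.ContinuousStrictlyIncreasing) (Y : ℤ → S → ℝ) (θ : Θ)
    {n : ℕ} (hn : 1 ≤ n) (ω : S) : m.empiricalJointCdf Y θ (1, 1) n ω = 1 := by
  have hn' : (n : ℝ) ≠ 0 := by positivity
  have h (t : ℤ) : indLe (m.residual Y θ t ω) (1 : ℝ) = 1 :=
    indLe_of_le (hF.F_lt_one _ _ _ _).le
  simp [empiricalJointCdf, h, hn']

lemma empiricalJointCdf_union_bound (hF : m.ContinuousStrictlyIncreasing) (Y : ℤ → S → ℝ) (θ : Θ)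
    {n : ℕ} (hn : 1 ≤ n) (r s : I) (ω : S) :
    m.empiricalJointCdf Y θ (r, 1) n ω + m.empiricalJointCdf Y θ (1, s) n ω ≤
      m.empiricalJointCdf Y θ (r, s) n ω + 1 := by
  rw [← empiricalJointCdf_one_one hF Y θ hn ω]
  unfold empiricalJointCdf
  simp only [← mul_add, ← Finset.sum_add_distrib]
  refine mul_le_mul_of_nonneg_left (Finset.sum_le_sum fun t _ => ?_) (by positivity)
  have h (t : ℤ) : indLe (m.residual Y θ t ω) (1 : I) = 1 :=
    indLe_of_le (hF.F_lt_one _ _ _ _).le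
  rw [h, h]
  -- For indicators `a` and `b`, `(1 - a) * (1 - b) ≥ 0` is `a + b ≤ a * b + 1`.
  nlinarith [mul_nonneg (sub_nonneg.2 (indLe_le_one (m.residual Y θ t ω) r))
    (sub_nonneg.2 (indLe_le_one (m.residual Y θ (t - 1) ω) s))]

end CondCdfFamily

/-! ### Convergence in probability and Markov's inequality without measurability -/

section Limits

variable {S : Type*} [MeasurableSpace S] {μ : Measure S}

/-- Subadditivity suffices, so the events need not be measurable. -/
lemma tendsto_measure_one_of_compl [IsProbabilityMeasure μ] {A : ℕ → Set S}
    (h : Tendsto (fun n => μ (A n)ᶜ) atTop (𝓝 0)) : Tendsto (fun n => μ (A n)) atTop (𝓝 1) := by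
  have h1 : Tendsto (fun n => 1 - μ (A n)ᶜ) atTop (𝓝 1) := by
    simpa using ENNReal.Tendsto.sub (tendsto_const_nhds (x := (1 : ℝ≥0∞))) h (Or.inl (by simp))
  refine tendsto_of_tendsto_of_tendsto_of_le_of_le h1 tendsto_const_nhds (fun n => ?_)
    fun n => prob_le_one
  rw [tsub_le_iff_right, ← measure_univ (μ := μ), ← Set.union_compl_self (A n)]
  exact measure_union_le _ _

lemma tendsto_measure_abs_sub_of_tendstoInMeasure {X : ℕ → S → ℝ} {p : ℝ}
    (h : TendstoInMeasure μ X atTop (fun _ => p)) {ε : ℝ} (hε : 0 < ε) :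
    Tendsto (fun n => μ {ω | ε ≤ |X n ω - p|}) atTop (𝓝 0) := by
  simpa [Real.dist_eq] using (tendstoInMeasure_iff_dist.1 h) ε hε

/-- Finitely many variables converging in probability to constants are simultaneously close to
their limits at some outcome. -/
lemma exists_forall_abs_sub_lt [IsProbabilityMeasure μ] {κ : Type*} {X : κ → ℕ → S → ℝ} {p : κ → ℝ}
    (h : ∀ k, TendstoInMeasure μ (X k) atTop (fun _ => p k)) (s : Finset κ) {ε : ℝ} (hε : 0 < ε) :
    ∃ n ≥ 1, ∃ ω, ∀ k ∈ s, |X k n ω - p k| < ε := by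
  have h0 : Tendsto (fun n => ∑ k ∈ s, μ {ω | ε ≤ |X k n ω - p k|}) atTop (𝓝 0) := by
    simpa using tendsto_finsetSum s fun k _ => tendsto_measure_abs_sub_of_tendstoInMeasure (h k) hε
  obtain ⟨n, hn, hn1⟩ := ((h0.eventually_lt_const one_pos).and (eventually_ge_atTop 1)).exists
  refine ⟨n, hn1, ?_⟩
  by_contra! hcon
  have hU : (Set.univ : Set S) ⊆ ⋃ k ∈ s, {ω | ε ≤ |X k n ω - p k|} := by
    intro ω _
    obtain ⟨k, hk, hk'⟩ := hcon ω
    exact Set.mem_biUnion hk hk'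
  have := (measure_mono (μ := μ) hU).trans (measure_biUnion_finset_le s _)
  rw [measure_univ] at this
  exact absurd hn this.not_gt

/-- Markov's inequality, applied to each measurable majorant of `f`. -/
lemma mul_measure_le_outerExpectation (f : S → ℝ≥0∞) (δ : ℝ≥0∞) :
    δ * μ {ω | δ ≤ f ω} ≤ outerExpectation μ f := by
  refine le_iInf fun g => le_iInf fun hg => le_iInf fun hfg => ?_
  refine le_trans ?_ (mul_meas_ge_le_lintegral hg δ)
  gcongr
  exact hfg _

end Limits

/-! ### Consequences of smoothness; an interior point of deviation -/

namespace CondCdfFamily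

variable {L : ℕ} {Θ : Set (EuclideanSpace ℝ (Fin L))} {m : CondCdfFamily Θ} {S : Type*}
  [MeasurableSpace S] {μ : Measure S}

/-- Markov's inequality at the fixed level `δ`. The event is uniform in `u`, so a random estimator
may be substituted for `u`. -/
lemma SmoothAt.tendsto_measure {Y : ℤ → S → ℝ} {a : ℕ → ℝ} {θ₀ : Θ} (h : m.SmoothAt μ Y a θ₀)
    (ha : Tendsto a atTop (𝓝 0)) {M δ : ℝ} (hM : 0 < M) (hδ : 0 < δ) :
    Tendsto (fun n : ℕ => μ {ω | ¬ ∀ t ∈ Finset.Icc 1 n, ∀ u : Θ,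
      ‖(u : EuclideanSpace ℝ (Fin L)) - θ₀‖ ≤ M * a n → ∀ r : I,
        |m.eta (t : ℤ) r u θ₀ (history Y t ω) - r| < δ}) atTop (𝓝 0) := by
  obtain ⟨C, hC⟩ := h M hM
  have hδ' : ENNReal.ofReal δ ≠ 0 := by simpa using hδ
  have hlim : Tendsto (fun n => (ENNReal.ofReal δ)⁻¹ * ENNReal.ofReal (C * a n)) atTop (𝓝 0) := by
    have h1 : Tendsto (fun n => ENNReal.ofReal (C * a n)) atTop (𝓝 0) := by
      simpa using ENNReal.tendsto_ofReal (ha.const_mul C)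
    simpa using ENNReal.Tendsto.const_mul h1 (Or.inr (ENNReal.inv_ne_top.2 hδ'))
  refine tendsto_of_tendsto_of_tendsto_of_le_of_le' tendsto_const_nhds hlim
    (Eventually.of_forall fun n => bot_le) ?_
  filter_upwards [hC] with n hn
  have hM := (mul_measure_le_outerExpectation (μ := μ) _ (ENNReal.ofReal δ)).trans hn
  rw [← ENNReal.mul_le_iff_le_inv hδ' ENNReal.ofReal_ne_top]
  refine le_trans ?_ hM
  gcongr
  intro hcon
  push Not at hcon
  obtain ⟨t, ht, u, hu, r, hr⟩ := hcon
  exact (ENNReal.ofReal_le_ofReal hr).trans <| le_iSup₂_of_le t ht <| le_iSup₂_of_le u hu <|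
    le_iSup_of_le r le_rfl

/-- A nontrivial deviation of the limiting joint distribution from independence and uniformity is
visible at an interior point. -/
lemma exists_interior_ne [IsProbabilityMeasure μ] (hF : m.ContinuousStrictlyIncreasing)
    {Y : ℤ → S → ℝ} {θ : Θ} {P : I × I → ℝ}
    (hP : ∀ r, TendstoInMeasure μ (m.empiricalJointCdf Y θ r) atTop (fun _ => P r))
    (hne : ∃ r : I × I, P r - (r.1 : ℝ) * r.2 ≠ 0) :
    ∃ r : I × I, r.1 ∈ Set.Ioo 0 1 ∧ r.2 ∈ Set.Ioo 0 1 ∧ P r - (r.1 : ℝ) * r.2 ≠ 0 := by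
  classical
  by_contra! hcon
  have hint (x y : I) (hx : x ∈ Set.Ioo 0 1) (hy : y ∈ Set.Ioo 0 1) : P (x, y) = x * y := by
    linarith [hcon (x, y) hx hy]
  -- Inequalities between empirical distributions pass to `P` by evaluating at one outcome where all
  -- the values involved are near their limits.
  have mono {r s : I × I} (h : r ≤ s) : P r ≤ P s := by
    refine le_of_forall_pos_le_add fun ε hε => ?_
    obtain ⟨n, hn, ω, hω⟩ := exists_forall_abs_sub_lt hP {r, s} (half_pos hε)
    have h1 := abs_lt.1 (hω r (by simp))
    have h2 := abs_lt.1 (hω s (by simp))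
    linarith [m.empiricalJointCdf_mono Y θ h n ω]
  have union (r s : I) : P (r, 1) + P (1, s) ≤ P (r, s) + 1 := by
    refine le_of_forall_pos_le_add fun ε hε => ?_
    obtain ⟨n, hn, ω, hω⟩ := exists_forall_abs_sub_lt hP {(r, 1), (1, s), (r, s)}
      (by positivity : 0 < ε / 3)
    have h1 := abs_lt.1 (hω (r, 1) (by simp))
    have h2 := abs_lt.1 (hω (1, s) (by simp))
    have h3 := abs_lt.1 (hω (r, s) (by simp))
    linarith [empiricalJointCdf_union_bound hF Y θ hn r s ω]
  have eq_of {r : I × I} {q : ℝ}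
      (h : ∀ n ≥ 1, ∀ ω, m.empiricalJointCdf Y θ r n ω = q) : P r = q := by
    refine eq_of_forall_dist_le fun ε hε => ?_
    obtain ⟨n, hn, ω, hω⟩ := exists_forall_abs_sub_lt hP {r} hε
    have h1 := hω r (by simp)
    rw [h n hn ω] at h1
    rw [dist_comm]
    exact h1.le
  have approx {ε : ℝ} (hε : 0 < ε) : ∃ x : I, x ∈ Set.Ioo 0 1 ∧ 1 - ε < (x : ℝ) := by
    obtain ⟨x, hx1, hx2⟩ := exists_between (max_lt (sub_lt_self 1 hε) (zero_lt_one' ℝ))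
    rw [max_lt_iff] at hx1
    exact ⟨⟨x, hx1.2.le, hx2.le⟩, ⟨hx1.2, hx2⟩, hx1.1⟩
  have right (s : I) (hs : s ∈ Set.Ioo 0 1) : P (s, 1) = s := by
    refine eq_of_forall_dist_le fun ε hε => ?_
    obtain ⟨x, hx, hx'⟩ := approx hε
    have hs0 : (0 : ℝ) < s := hs.1
    have hs1 : (s : ℝ) < 1 := hs.2
    have hx1 : (x : ℝ) < 1 := hx.2
    have h1 : P (s, x) ≤ P (s, 1) := mono ⟨le_rfl, hx.2.le⟩
    -- This bounds `P (s, 1)` from above using interior values only; letting `y`, then `x`, increase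
    -- to 1 matches the lower bound `s * x`.
    have h2 : ∀ y : I, y ∈ Set.Ioo 0 1 → P (s, 1) ≤ s * x + 1 - y * x := fun y hy => by
      have h3 := union s x
      have h4 : P (y, x) ≤ P (1, x) := mono ⟨hy.2.le, le_rfl⟩
      rw [hint _ _ hs hx] at h3
      rw [hint _ _ hy hx] at h4
      linarith
    rw [hint _ _ hs hx] at h1
    have h5 : P (s, 1) ≤ s * x + 1 - x := by
      refine le_of_forall_pos_le_add fun ε' hε' => ?_
      obtain ⟨y, hy, hy'⟩ := approx hε'
      have hx0 : (0 : ℝ) < x := hx.1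
      nlinarith [h2 y hy, mul_nonneg (sub_nonneg.2 hy'.le) hx0.le]
    rw [Real.dist_eq, abs_le]
    constructor <;> nlinarith
  have left (s : I) (hs : s ∈ Set.Ioo 0 1) : P (1, s) = s := by
    refine eq_of_forall_dist_le fun ε hε => ?_
    obtain ⟨x, hx, hx'⟩ := approx hε
    have hs0 : (0 : ℝ) < s := hs.1
    have hs1 : (s : ℝ) < 1 := hs.2
    have hx1 : (x : ℝ) < 1 := hx.2
    have h1 : P (x, s) ≤ P (1, s) := mono ⟨hx.2.le, le_rfl⟩
    have h3 := union x s
    rw [hint _ _ hx hs] at h1 h3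
    rw [right x hx] at h3
    rw [Real.dist_eq, abs_le]
    constructor <;> nlinarith
  have cases (x : I) : x = 0 ∨ x = 1 ∨ x ∈ Set.Ioo (0 : I) 1 := by
    rcases eq_or_ne x 0 with h | h
    · exact Or.inl h
    rcases eq_or_ne x 1 with h' | h'
    · exact Or.inr (Or.inl h')
    exact Or.inr (Or.inr ⟨unitInterval.pos_iff_ne_zero.2 h, unitInterval.lt_one_iff_ne_one.2 h'⟩)
  obtain ⟨⟨x, y⟩, hxy⟩ := hne
  apply hxy
  simp only
  rcases cases x with rfl | rfl | hx
  · simp [eq_of fun n _ ω => empiricalJointCdf_zero_left hF Y θ y n ω]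
  · rcases cases y with rfl | rfl | hy
    · simp [eq_of fun n _ ω => empiricalJointCdf_zero_right hF Y θ 1 n ω]
    · simp [eq_of fun n hn ω => empiricalJointCdf_one_one hF Y θ hn ω]
    · simp [left y hy]
  · rcases cases y with rfl | rfl | hy
    · simp [eq_of fun n _ ω => empiricalJointCdf_zero_right hF Y θ x n ω]
    · simp [right x hx]
    · simp [hint x y hx hy]

end CondCdfFamily

/-! ### Lower bounds for the estimated process -/

namespace CondCdfFamily

variable {L : ℕ} {Θ : Set (EuclideanSpace ℝ (Fin L))} {m : CondCdfFamily Θ} {S : Type*}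

lemma measurable_Vhat (Y : ℤ → S → ℝ) (θhat : ℕ → S → Θ) (n : ℕ) (ω : S) :
    Measurable (m.Vhat Y θhat n ω) := by
  unfold Vhat
  refine (Finset.measurable_sum _ fun t _ => ?_).const_mul _
  have h1 : Measurable fun r : I × I => (r.1 : ℝ) := measurable_subtype_coe.comp measurable_fst
  have h2 : Measurable fun r : I × I => (r.2 : ℝ) := measurable_subtype_coe.comp measurable_snd
  exact (((measurable_indLe_left _).comp h1).mul ((measurable_indLe_left _).comp h2)).sub
    (h1.mul h2)

lemma exists_bound_Vhat (Y : ℤ → S → ℝ) (θhat : ℕ → S → Θ) (n : ℕ) (ω : S) :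
    ∃ C : ℝ, ∀ r, |m.Vhat Y θhat n ω r| ≤ C := by
  refine ⟨|1 / √((n : ℝ) - 1)| * ∑ t ∈ Finset.Icc 2 n, (1 : ℝ), fun r => ?_⟩
  unfold Vhat
  rw [abs_mul]
  refine mul_le_mul_of_nonneg_left ((Finset.abs_sum_le_sum_abs _ _).trans
    (Finset.sum_le_sum fun t _ => ?_)) (abs_nonneg _)
  have h1 := mul_nonneg (indLe_nonneg (m.residual Y (θhat n ω) t ω) r.1)
    (indLe_nonneg (m.residual Y (θhat n ω) (t - 1) ω) r.2)
  have h2 := mul_le_one₀ (indLe_le_one (m.residual Y (θhat n ω) t ω) r.1) (indLe_nonneg _ _)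
    (indLe_le_one (m.residual Y (θhat n ω) (t - 1) ω) r.2)
  have h3 := mul_nonneg r.1.2.1 r.2.2.1
  have h4 := mul_le_one₀ r.1.2.2 r.2.2.1 r.2.2.2
  rw [abs_le]
  constructor <;> linarith

lemma Vhat_eq (Y : ℤ → S → ℝ) (θhat : ℕ → S → Θ) {n : ℕ} (hn : 2 ≤ n) (ω : S) (r : I × I) :
    m.Vhat Y θhat n ω r = (1 / √((n : ℝ) - 1)) *
      (∑ t ∈ Finset.Icc 2 n, indLe (m.residual Y (θhat n ω) (t : ℤ) ω) r.1 *
        indLe (m.residual Y (θhat n ω) ((t : ℤ) - 1) ω) r.2 - ((n : ℝ) - 1) * (r.1 * r.2)) := by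
  unfold Vhat
  rw [Finset.sum_sub_distrib, Finset.sum_const, Nat.card_Icc, nsmul_eq_mul]
  congr 3
  rw [show n + 1 - 2 = n - 1 by omega, Nat.cast_sub (by omega), Nat.cast_one]

/-- The two sums differ by the term `t = 1`, which lies in `[0, 1]`. -/
lemma sum_Icc_two_le_empirical (Y : ℤ → S → ℝ) (θ : Θ) (r : I × I) {n : ℕ} (hn : 2 ≤ n) (ω : S) :
    ∑ t ∈ Finset.Icc 2 n, indLe (m.residual Y θ (t : ℤ) ω) r.1 *
        indLe (m.residual Y θ ((t : ℤ) - 1) ω) r.2 ≤ n * m.empiricalJointCdf Y θ r n ω ∧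
      n * m.empiricalJointCdf Y θ r n ω ≤
        1 + ∑ t ∈ Finset.Icc 2 n, indLe (m.residual Y θ (t : ℤ) ω) r.1 *
          indLe (m.residual Y θ ((t : ℤ) - 1) ω) r.2 := by
  have hn' : (n : ℝ) ≠ 0 := by positivity
  unfold empiricalJointCdf
  rw [← mul_assoc, mul_one_div_cancel hn', one_mul,
    ← Finset.add_sum_Ioc_eq_sum_Icc (by omega : 1 ≤ n),
    show Finset.Ioc 1 n = Finset.Icc 2 n from rfl]
  have h1 := mul_nonneg (indLe_nonneg (m.residual Y θ (1 : ℕ) ω) r.1)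
    (indLe_nonneg (m.residual Y θ ((1 : ℕ) - 1) ω) r.2)
  have h2 := mul_le_one₀ (indLe_le_one (m.residual Y θ (1 : ℕ) ω) r.1) (indLe_nonneg _ _)
    (indLe_le_one (m.residual Y θ ((1 : ℕ) - 1) ω) r.2)
  constructor <;> linarith

lemma sum_indLe_mono {Y : ℤ → S → ℝ} {θ θ' : Θ} {r r' : I × I} {n : ℕ} {ω : S}
    (h₁ : ∀ t ∈ Finset.Icc 1 n, m.residual Y θ (t : ℕ) ω ≤ r.1 → m.residual Y θ' (t : ℕ) ω ≤ r'.1)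
    (h₂ : ∀ t ∈ Finset.Icc 1 n, m.residual Y θ (t : ℕ) ω ≤ r.2 →
      m.residual Y θ' (t : ℕ) ω ≤ r'.2) :
    ∑ t ∈ Finset.Icc 2 n, indLe (m.residual Y θ (t : ℤ) ω) r.1 *
        indLe (m.residual Y θ ((t : ℤ) - 1) ω) r.2 ≤
      ∑ t ∈ Finset.Icc 2 n, indLe (m.residual Y θ' (t : ℤ) ω) r'.1 *
        indLe (m.residual Y θ' ((t : ℤ) - 1) ω) r'.2 := by
  refine Finset.sum_le_sum fun t ht => ?_
  rw [Finset.mem_Icc] at ht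
  -- As `t ≥ 2`, the lagged index `t - 1` still lies in `1, …, n`, where the hypotheses apply.
  have hc : ((t : ℤ) - 1) = ((t - 1 : ℕ) : ℤ) := by omega
  rw [hc]
  exact mul_le_mul (indLe_le_indLe (h₁ t (Finset.mem_Icc.2 (by omega))))
    (indLe_le_indLe (h₂ (t - 1) (Finset.mem_Icc.2 (by omega)))) (indLe_nonneg _ _)
    (indLe_nonneg _ _)

end CondCdfFamily

lemma sqrt_mul_sub_two_le {N D x : ℝ} (hN : 1 ≤ N) (hx : N * (D / 2) - 2 ≤ x) :
    √N * (D / 2) - 2 ≤ 1 / √N * x := by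
  have hs : 1 ≤ √N := Real.one_le_sqrt.2 hN
  have hsq : √N * √N = N := Real.mul_self_sqrt (by linarith)
  have hexp : (√N * (D / 2) - 2) * √N = N * (D / 2) - 2 * √N := by
    linear_combination (D / 2) * hsq
  rw [one_div, inv_mul_eq_div, le_div_iff₀ (by linarith), hexp]
  linarith

namespace CondCdfFamily

variable {L : ℕ} {Θ : Set (EuclideanSpace ℝ (Fin L))} {m : CondCdfFamily Θ} {S : Type*}

/-- If the empirical joint distribution at `r₀` is close to `p ≠ r₀.1 * r₀.2`, then `|V̂|` is of
order `√n` on an open box depending only on `p` and `r₀`. -/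
lemma exists_isOpen_le_abs_Vhat (hF : m.ContinuousStrictlyIncreasing) (Y : ℤ → S → ℝ) (θ₁ : Θ)
    {r₀ : I × I} (h₁ : r₀.1 ∈ Set.Ioo 0 1) (h₂ : r₀.2 ∈ Set.Ioo 0 1) {p : ℝ}
    (hp : p - (r₀.1 : ℝ) * r₀.2 ≠ 0) :
    ∃ R : Set (I × I), IsOpen R ∧ R.Nonempty ∧ ∃ δ > 0, ∃ D > 0,
      ∀ (θhat : ℕ → S → Θ) (n : ℕ) (ω : S), 2 ≤ n →
        (∀ t ∈ Finset.Icc 1 n, ∀ r : I,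
          |m.eta ((t : ℕ) : ℤ) r (θhat n ω) θ₁ (history Y t ω) - r| < δ) →
        |m.empiricalJointCdf Y θ₁ r₀ n ω - p| < D / 4 →
        ∀ r ∈ R, √((n : ℝ) - 1) * (D / 2) - 2 ≤ |m.Vhat Y θhat n ω r| := by
  obtain ⟨⟨x, hx⟩, ⟨y, hy⟩⟩ := r₀
  have hx0 : 0 < x := h₁.1
  have hx1 : x < 1 := h₁.2
  have hy0 : 0 < y := h₂.1
  have hy1 : y < 1 := h₂.2
  simp only at hp
  have hcx : Continuous fun r : I × I => (r.1 : ℝ) := continuous_subtype_val.comp continuous_fst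
  have hcy : Continuous fun r : I × I => (r.2 : ℝ) := continuous_subtype_val.comp continuous_snd
  rcases lt_or_gt_of_ne hp with hd | hd
  -- Deficit, `D = xy - p`. The bounds `x/2` and `y/2` keep the box inside the square. On it `r₁r₂ ≥
  -- xy - 4δ`, and `4δ < D/4` together with the empirical error `D/4` leaves `D/2`.
  · obtain ⟨δ, hδ0, hδ⟩ := exists_between (lt_min (lt_min (half_pos hx0) (half_pos hy0))
      (by linarith : 0 < -(p - x * y) / 16))
    simp only [lt_min_iff] at hδ
    obtain ⟨⟨hδx, hδy⟩, hδd⟩ := hδ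
    refine ⟨{r | (x - 2 * δ < r.1 ∧ (r.1 : ℝ) < x - δ) ∧
      (y - 2 * δ < r.2 ∧ (r.2 : ℝ) < y - δ)}, ?_, ?_, δ, hδ0, -(p - x * y), by linarith, ?_⟩
    · exact ((isOpen_lt continuous_const hcx).inter (isOpen_lt hcx continuous_const)).inter
        ((isOpen_lt continuous_const hcy).inter (isOpen_lt hcy continuous_const))
    · refine ⟨(⟨x - 3 / 2 * δ, by constructor <;> linarith⟩,
        ⟨y - 3 / 2 * δ, by constructor <;> linarith⟩), ?_⟩
      simp only [Set.mem_ofPred_eq]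
      refine ⟨⟨?_, ?_⟩, ?_, ?_⟩ <;> linarith
    · rintro θhat n ω hn hη hemp r ⟨⟨ha, hb⟩, hc, hd'⟩
      rw [abs_lt] at hemp
      have hsum := (sum_indLe_mono (m := m) (Y := Y) (θ := θhat n ω) (θ' := θ₁) (r := r)
        (r' := (⟨x, hx⟩, ⟨y, hy⟩)) (n := n) (ω := ω)
        (fun t ht h => by
          have := (abs_lt.1 (hη t ht r.1)).2
          exact ((residual_le_iff_eta hF Y _ θ₁ _ ω r.1).1 h).trans (by simp only; linarith))
        (fun t ht h => by
          have := (abs_lt.1 (hη t ht r.2)).2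
          exact ((residual_le_iff_eta hF Y _ θ₁ _ ω r.2).1 h).trans (by simp only; linarith))).trans
        (sum_Icc_two_le_empirical Y θ₁ _ hn ω).1
      rw [← abs_neg, Vhat_eq Y θhat hn, ← mul_neg]
      refine (sqrt_mul_sub_two_le ?_ ?_).trans (le_abs_self _)
      · have : (2 : ℝ) ≤ n := by exact_mod_cast hn
        linarith
      · have hn' : (2 : ℝ) ≤ n := by exact_mod_cast hn
        have hr : x * y - 4 * δ ≤ r.1 * r.2 := by
          have := mul_le_mul ha.le hc.le (by linarith) r.1.2.1
          nlinarith
        have e1 := mul_le_mul_of_nonneg_left hr (by linarith : (0 : ℝ) ≤ n - 1)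
        have e2 := mul_le_mul_of_nonneg_left hemp.2.le (by linarith : (0 : ℝ) ≤ n)
        have e3 := mul_le_mul_of_nonneg_left hδd.le (by linarith : (0 : ℝ) ≤ n - 1)
        have e4 : x * y ≤ 1 := by nlinarith
        nlinarith
  -- Excess, `D = p - xy`. On the box `r₁r₂ ≤ xy + 8δ`, and `8δ < D/4`.
  · obtain ⟨δ, hδ0, hδ⟩ := exists_between (lt_min (lt_min (half_pos (sub_pos.2 hx1))
      (half_pos (sub_pos.2 hy1))) (by linarith : 0 < (p - x * y) / 32))
    simp only [lt_min_iff] at hδ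
    obtain ⟨⟨hδx, hδy⟩, hδd⟩ := hδ
    refine ⟨{r | (x + δ < r.1 ∧ (r.1 : ℝ) < x + 2 * δ) ∧
      (y + δ < r.2 ∧ (r.2 : ℝ) < y + 2 * δ)}, ?_, ?_, δ, hδ0, p - x * y, by linarith, ?_⟩
    · exact ((isOpen_lt continuous_const hcx).inter (isOpen_lt hcx continuous_const)).inter
        ((isOpen_lt continuous_const hcy).inter (isOpen_lt hcy continuous_const))
    · refine ⟨(⟨x + 3 / 2 * δ, by constructor <;> linarith⟩,
        ⟨y + 3 / 2 * δ, by constructor <;> linarith⟩), ?_⟩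
      simp only [Set.mem_ofPred_eq]
      refine ⟨⟨?_, ?_⟩, ?_, ?_⟩ <;> linarith
    · rintro θhat n ω hn hη hemp r ⟨⟨ha, hb⟩, hc, hd'⟩
      rw [abs_lt] at hemp
      have hsum := (sum_Icc_two_le_empirical Y θ₁ _ hn ω).2.trans (add_le_add_right
        (sum_indLe_mono (m := m) (Y := Y) (θ' := θhat n ω) (θ := θ₁) (r' := r)
        (r := (⟨x, hx⟩, ⟨y, hy⟩)) (n := n) (ω := ω)
        (fun t ht h => by
          have := (abs_lt.1 (hη t ht r.1)).1
          exact (residual_le_iff_eta hF Y _ θ₁ _ ω r.1).2 (h.trans (by simp only; linarith)))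
        (fun t ht h => by
          have := (abs_lt.1 (hη t ht r.2)).1
          exact (residual_le_iff_eta hF Y _ θ₁ _ ω r.2).2
            (h.trans (by simp only; linarith)))) 1)
      rw [Vhat_eq Y θhat hn]
      refine (sqrt_mul_sub_two_le ?_ ?_).trans (le_abs_self _)
      · have : (2 : ℝ) ≤ n := by exact_mod_cast hn
        linarith
      · have hn' : (2 : ℝ) ≤ n := by exact_mod_cast hn
        have hr : (r.1 : ℝ) * r.2 ≤ x * y + 8 * δ := by
          have := mul_le_mul hb.le hd'.le r.2.2.1 (by linarith)
          nlinarith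
        have e1 := mul_le_mul_of_nonneg_left hr (by linarith : (0 : ℝ) ≤ n - 1)
        have e2 := mul_le_mul_of_nonneg_left hemp.1.le (by linarith : (0 : ℝ) ≤ n)
        have e3 := mul_le_mul_of_nonneg_left hδd.le (by linarith : (0 : ℝ) ≤ n - 1)
        have e4 : 0 ≤ x * y := by positivity
        nlinarith

/-- Under a fixed alternative `|V̂|` diverges in probability, uniformly on some open set. -/
lemma exists_isOpen_tendsto_measure_Vhat [MeasurableSpace S] {μ : Measure S}
    [IsProbabilityMeasure μ] (hF : m.ContinuousStrictlyIncreasing) {Y : ℤ → S → ℝ}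
    {θ₁ : Θ} {P : I × I → ℝ}
    (hP : ∀ r, TendstoInMeasure μ (m.empiricalJointCdf Y θ₁ r) atTop (fun _ => P r))
    (hne : ∃ r : I × I, P r - (r.1 : ℝ) * r.2 ≠ 0) {θhat : ℕ → S → Θ} {a : ℕ → ℝ}
    (ha_pos : ∀ᶠ n in atTop, 0 < a n) (ha : Tendsto a atTop (𝓝 0))
    (hrate : IsBigOInProb μ (fun n ω => (θhat n ω : EuclideanSpace ℝ (Fin L)) - θ₁) a)
    (hsmooth : m.SmoothAt μ Y a θ₁) :
    ∃ R : Set (I × I), IsOpen R ∧ R.Nonempty ∧ ∀ K : ℝ,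
      Tendsto (fun n => μ {ω | ¬ ∀ r ∈ R, K ≤ |m.Vhat Y θhat n ω r|}) atTop (𝓝 0) := by
  obtain ⟨r₀, h₁, h₂, hr₀⟩ := exists_interior_ne hF hP hne
  obtain ⟨R, hRo, hRn, δ, hδ, D, hD, hR⟩ := exists_isOpen_le_abs_Vhat hF Y θ₁ h₁ h₂ hr₀
  refine ⟨R, hRo, hRn, fun K => ?_⟩
  have hK : ∀ᶠ n : ℕ in atTop, K ≤ √((n : ℝ) - 1) * (D / 2) - 2 := by
    have h1 : Tendsto (fun n : ℕ => √((n : ℝ) - 1)) atTop atTop :=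
      Real.tendsto_sqrt_atTop.comp
        (tendsto_atTop_add_const_right _ (-1) tendsto_natCast_atTop_atTop)
    exact (tendsto_atTop_add_const_right _ (-2)
      (h1.atTop_mul_const (half_pos hD))).eventually_ge_atTop K
  refine ENNReal.tendsto_nhds_zero.2 fun ε hε => ?_
  have hε3 : 0 < ε / 3 := ENNReal.div_pos hε.ne' (by simp)
  obtain ⟨M, hM⟩ := hrate (ε / 3) hε3
  have hη := ENNReal.tendsto_nhds_zero.1
    -- The `M` from the rate may be nonpositive, whereas `SmoothAt` needs a positive radius
    -- constant.
    (hsmooth.tendsto_measure ha (lt_max_of_lt_right one_pos : 0 < max M 1) hδ) (ε / 3) hε3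
  have hemp := ENNReal.tendsto_nhds_zero.1
    (tendsto_measure_abs_sub_of_tendstoInMeasure (hP r₀) (by positivity : 0 < D / 4)) (ε / 3) hε3
  filter_upwards [hK, hM, hη, hemp, ha_pos, eventually_ge_atTop 2] with n h1 h2 h3 h4 h5 h6
  calc _ ≤ _ := measure_mono (t := ({ω | M * a n < ‖(θhat n ω : EuclideanSpace ℝ (Fin L)) - θ₁‖} ∪
          {ω | ¬ ∀ t ∈ Finset.Icc 1 n, ∀ u : Θ,
            ‖(u : EuclideanSpace ℝ (Fin L)) - θ₁‖ ≤ max M 1 * a n → ∀ r : I,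
              |m.eta ((t : ℕ) : ℤ) r u θ₁ (history Y t ω) - r| < δ}) ∪
          {ω | D / 4 ≤ |m.empiricalJointCdf Y θ₁ r₀ n ω - P r₀|}) ?_
    _ ≤ ε / 3 + ε / 3 + ε / 3 :=
      (measure_union_le _ _).trans (add_le_add ((measure_union_le _ _).trans (add_le_add h2 h3)) h4)
    _ = ε := ENNReal.add_thirds ε
  intro ω hω
  by_contra hcon
  simp only [Set.mem_union, Set.mem_ofPred_eq, not_or, not_not, not_lt, not_le] at hcon
  obtain ⟨⟨c1, c2⟩, c3⟩ := hcon
  refine hω fun r hr => h1.trans (hR θhat n ω h6 (fun t ht r => c2 t ht _ ?_ r) c3 r hr)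
  exact c1.trans (mul_le_mul_of_nonneg_right (le_max_left _ _) h5.le)

end CondCdfFamily

/-! ### Functionals that detect divergence -/

section Functionals

/-- Otherwise counterexamples for `K = 0, 1, 2, …` would diverge on `R` with `Γ` bounded by `M`.
This threshold form can be applied outcome by outcome, as divergence in probability requires. -/
lemma DetectsDivergence.exists_lower_bound {Γ : (I × I → ℝ) → ℝ} (hΓ : DetectsDivergence Γ)
    {R : Set (I × I)} (hRo : IsOpen R) (hRn : R.Nonempty) (M : ℝ) :
    ∃ K : ℝ, ∀ v : I × I → ℝ, Measurable v → (∃ C : ℝ, ∀ r, |v r| ≤ C) →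
      (∀ r ∈ R, K ≤ |v r|) → M < Γ v := by
  by_contra! hcon
  choose v hv hvb hvR hvΓ using fun n : ℕ => hcon n
  have h := hΓ R hRo hRn v hv hvb fun K => by
    filter_upwards [tendsto_natCast_atTop_atTop.eventually_ge_atTop K] with n hn r hr
    exact hn.trans (hvR n r hr)
  obtain ⟨n, hn⟩ := (h.eventually_gt_atTop M).exists
  exact absurd (hvΓ n) hn.not_ge

lemma detectsDivergence_ksFunctional : DetectsDivergence ksFunctional := by
  rintro R - ⟨r, hr⟩ v - hvb hdiv
  refine tendsto_atTop.2 fun K => ?_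
  filter_upwards [hdiv K] with n hn
  obtain ⟨C, hC⟩ := hvb n
  exact (hn r hr).trans (le_ciSup (f := fun r => |v n r|) ⟨C, by rintro _ ⟨r, rfl⟩; exact hC r⟩ r)

instance unitInterval.isOpenPosMeasure_volume : (volume : Measure I).IsOpenPosMeasure := by
  refine ⟨fun U hU hne => ?_⟩
  obtain ⟨V, hV, rfl⟩ := isOpen_induced_iff.1 hU
  obtain ⟨x, hx⟩ := hne
  have hx' : (x : ℝ) ∈ closure (Set.Ioo (0 : ℝ) 1) := by
    rw [closure_Ioo zero_ne_one]
    exact x.2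
  have hpos : 0 < volume (V ∩ Set.Ioo (0 : ℝ) 1) :=
    (hV.inter isOpen_Ioo).measure_pos _ (mem_closure_iff.1 hx' V hV hx)
  rw [unitInterval.volume_apply, Subtype.image_preimage_coe]
  refine (hpos.trans_le (measure_mono ?_)).ne'
  rintro z ⟨hz, hz'⟩
  exact ⟨⟨hz'.1.le, hz'.2.le⟩, hz⟩

lemma detectsDivergence_cvmFunctional : DetectsDivergence cvmFunctional := by
  intro R hRo hRn v hv hvb hdiv
  have hpos : 0 < (volume : Measure (I × I)).real R :=
    ENNReal.toReal_pos (hRo.measure_pos _ hRn).ne' (measure_ne_top _ _)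
  refine tendsto_atTop.2 fun K => ?_
  -- With `q = |K| / vol R`, the added 1 gives `v² ≥ (1 + q)² ≥ q` even when `q < 1`.
  filter_upwards [hdiv (1 + |K| / (volume : Measure (I × I)).real R)] with n hn
  obtain ⟨C, hC⟩ := hvb n
  have hint : Integrable (fun r => v n r ^ 2) (volume : Measure (I × I)) :=
    Integrable.of_bound ((hv n).pow_const 2).aestronglyMeasurable (C ^ 2)
      (Eventually.of_forall fun r => by
        rw [norm_pow]
        exact pow_le_pow_left₀ (norm_nonneg _) (hC r) 2)
  have hq : 0 ≤ |K| / (volume : Measure (I × I)).real R := by positivity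
  calc K ≤ |K| := le_abs_self K
    _ = ∫ _ in R, |K| / (volume : Measure (I × I)).real R := by
      rw [setIntegral_const, smul_eq_mul, mul_div_cancel₀ _ hpos.ne']
    _ ≤ ∫ r in R, v n r ^ 2 := by
      refine setIntegral_mono_on (integrable_const _) hint.integrableOn hRo.measurableSet fun r hr => ?_
      rw [← sq_abs]
      nlinarith [hn r hr]
    _ ≤ cvmFunctional (v n) :=
      setIntegral_le_integral hint (Eventually.of_forall fun r => sq_nonneg _)

end Functionals

/-- A test statistic that detects divergence exceeds every stochastically bounded critical value
with probability tending to one, along random functions diverging in probability. -/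
lemma DetectsDivergence.tendsto_measure {S : Type*} [MeasurableSpace S] {μ : Measure S}
    [IsProbabilityMeasure μ] {Γ : (I × I → ℝ) → ℝ} (hΓ : DetectsDivergence Γ)
    {V : ℕ → S → I × I → ℝ} (hVm : ∀ n ω, Measurable (V n ω))
    (hVb : ∀ n ω, ∃ C : ℝ, ∀ r, |V n ω r| ≤ C) {R : Set (I × I)} (hRo : IsOpen R)
    (hRn : R.Nonempty)
    (hV : ∀ K : ℝ, Tendsto (fun n => μ {ω | ¬ ∀ r ∈ R, K ≤ |V n ω r|}) atTop (𝓝 0))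
    {c : ℕ → S → ℝ} (hc : IsBigOInProb μ c (fun _ => 1)) :
    Tendsto (fun n => μ {ω | c n ω < Γ (V n ω)}) atTop (𝓝 1) := by
  refine tendsto_measure_one_of_compl (ENNReal.tendsto_nhds_zero.2 fun ε hε => ?_)
  have hε2 : 0 < ε / 2 := ENNReal.half_pos hε.ne'
  obtain ⟨M, hM⟩ := hc (ε / 2) hε2
  obtain ⟨K, hK⟩ := hΓ.exists_lower_bound hRo hRn M
  filter_upwards [hM, ENNReal.tendsto_nhds_zero.1 (hV K) (ε / 2) hε2] with n h1 h2
  calc _ ≤ _ := measure_mono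
        (t := {ω | M * 1 < ‖c n ω‖} ∪ {ω | ¬ ∀ r ∈ R, K ≤ |V n ω r|}) ?_
    _ ≤ ε / 2 + ε / 2 := (measure_union_le _ _).trans (add_le_add h1 h2)
    _ = ε := ENNReal.add_halves ε
  intro ω hω
  by_contra hcon
  simp only [Set.mem_union, Set.mem_ofPred_eq, not_or, not_not, not_lt, mul_one] at hcon
  exact hω (((le_abs_self _).trans hcon.1).trans_lt (hK _ (hVm n ω) (hVb n ω) hcon.2))

/-- Consistency against a fixed alternative of the tests that reject when `Γ(V̂_{2n}) > c_n`. -/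
theorem mainTheorem5 {S : Type*} [MeasurableSpace S] (μ : Measure S) [IsProbabilityMeasure μ]
    {L : ℕ} (Θ : Set (EuclideanSpace ℝ (Fin L))) (m : CondCdfFamily Θ)
    (hF : m.ContinuousStrictlyIncreasing)
    -- the observed series
    (Y : ℤ → S → ℝ) (hY : ∀ t, Measurable (Y t))
    -- existence of `P₂(r) = P₂(r; θ₀)` for every `θ₀ ∈ Θ`
    (P₂ : Θ → I × I → ℝ)
    (hP₂ : ∀ (θ₀ : Θ) (r : I × I),
      TendstoInMeasure μ (m.empiricalJointCdf Y θ₀ r) atTop (fun _ => P₂ θ₀ r))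
    -- the fixed alternative
    (hH₁ : ∀ θ₀ : Θ, ∃ r : I × I, P₂ θ₀ r - (r.1 : ℝ) * (r.2 : ℝ) ≠ 0)
    -- the estimator and its pseudo-true limit, approached at a rate `a n → 0` (e.g. `n ^ (-1/2)`)
    (θhat : ℕ → S → Θ) (hθhat : ∀ n, Measurable (θhat n)) (θ₁ : Θ)
    (hθ₁ : TendstoInMeasure μ θhat atTop (fun _ => θ₁))
    (a : ℕ → ℝ) (ha_pos : ∀ᶠ n in atTop, 0 < a n) (ha : Tendsto a atTop (𝓝 0))
    (hrate : IsBigOInProb μ (fun n ω => (θhat n ω : EuclideanSpace ℝ (Fin L)) - θ₁) a)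
    -- smoothness in the parameter on the corresponding neighbourhoods of `θ₁`
    (hsmooth : m.SmoothAt μ Y a θ₁)
    -- critical values
    (c : ℕ → S → ℝ) (hc : ∀ n, Measurable (c n)) (hcO : IsBigOInProb μ c (fun _ => 1)) :
    Tendsto (fun n => μ {ω | c n ω < ksFunctional (m.Vhat Y θhat n ω)}) atTop (𝓝 1) ∧
    Tendsto (fun n => μ {ω | c n ω < cvmFunctional (m.Vhat Y θhat n ω)}) atTop (𝓝 1) ∧
    ∀ Γ : (I × I → ℝ) → ℝ, DetectsDivergence Γ →
      (∀ n, Measurable fun ω => Γ (m.Vhat Y θhat n ω)) →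
      Tendsto (fun n => μ {ω | c n ω < Γ (m.Vhat Y θhat n ω)}) atTop (𝓝 1) := by
  obtain ⟨R, hRo, hRn, hR⟩ := CondCdfFamily.exists_isOpen_tendsto_measure_Vhat hF (hP₂ θ₁)
    (hH₁ θ₁) ha_pos ha hrate hsmooth
  have key (Γ : (I × I → ℝ) → ℝ) (hΓ : DetectsDivergence Γ) :
      Tendsto (fun n => μ {ω | c n ω < Γ (m.Vhat Y θhat n ω)}) atTop (𝓝 1) :=
    hΓ.tendsto_measure (fun n ω => CondCdfFamily.measurable_Vhat Y θhat n ω)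
      (fun n ω => CondCdfFamily.exists_bound_Vhat Y θhat n ω) hRo hRn hR hcO
  exact ⟨key _ detectsDivergence_ksFunctional, key _ detectsDivergence_cvmFunctional,
    fun Γ hΓ _ => key Γ hΓ⟩
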